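/- **Corollary 3.6.** Let $I\subseteq\mathbb R$ be a nonempty open interval with $\inf I=-\infty$, let $a\colon I\to(0,\infty)$ be smooth, and let $H=\dot a/a$. Suppose that there is $H_\Lambda>0$ with $$\lim_{t\to-\infty}H(t)=H_\Lambda ,\qquad \lim_{t\to-\infty}\dot H(t)=0 ,$$ i.e. the flat FLRW spacetime $M=I\times\mathbb R^3$, $g=-dt^2+a(t)^2(dx^2+dy^2+dz^2)$, time oriented by $\partial_t$, is past-asymptotically de Sitter. Then $(M,g)$ is continuously ($C^0$) extendible, through its past end: there are a $C^0$ spacetime $(M_{\rm ext},g_{\rm ext})$ and an isometric, time-orientation preserving $C^1$ embedding of $(M,g)$ onto a proper open subset of $M_{\rm ext}$ such that the past boundary $\partial^-M$ of $M$ within $M_{\rm ext}$ is nonempty. Here a $C^0$ spacetime is a connected, Hausdorff, second countable four-dimensional $C^1$ manifold with a continuous Lorentzian metric of signature $(-,+,+,+)$ and a time orientation induced by a continuous timelike vector field; and $\partial^-M$ is the set of points $p$ of the topological boundary of $M$ in $M_{\rm ext}$ for which there is a future-directed timelike curve $\gamma\colon[\alpha,\beta]\to M_{\rm ext}$, piecewise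 $C^1$ and with future-directed timelike velocity everywhere (including all one-sided velocities), with $\gamma(\alpha)=p$ and $\gamma((\alpha,\beta])\subset M$. -/

import Mathlib

open Set Filter Topology Bundle Manifold TopologicalSpace
open scoped ContDiff

noncomputable section

/-! ### Spacetimes -/

/-- The model space `ℝ⁴`, written as time times space. -/
abbrev R4 : Type := ℝ × EuclideanSpace ℝ (Fin 3)

/-- A bilinear form of Lorentzian signature `(-,+,+,+)`: symmetric, negative on some vector `u`,
and positive definite on the orthogonal complement of `u`. -/
def IsLorentzForm {V : Type*} [AddCommGroup V] [Module ℝ V] [TopologicalSpace V]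
    (B : V →L[ℝ] V →L[ℝ] ℝ) : Prop :=
  (∀ v w, B v w = B w v) ∧
    ∃ u, B u u < 0 ∧ ∀ w, B u w = 0 → w ≠ 0 → 0 < B w w

/-- A `C^k` spacetime: a connected, Hausdorff, second countable `C^{k+1}` manifold of dimension
four, a `C^k` Lorentzian metric (a `C^k` section of the bundle of bilinear forms on the tangent
spaces), and a time orientation induced by a continuous timelike vector field `timeField`. -/
structure Spacetime (k : ℕ∞) where
  carrier : Type
  [topology : TopologicalSpace carrier]
  [t2 : T2Space carrier]
  [secondCountable : SecondCountableTopology carrier]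
  [connected : ConnectedSpace carrier]
  [charted : ChartedSpace R4 carrier]
  [manifold : IsManifold 𝓘(ℝ, R4) ((k : ℕ∞ω) + 1) carrier]
  metric : ∀ p : carrier,
    TangentSpace 𝓘(ℝ, R4) p →L[ℝ] TangentSpace 𝓘(ℝ, R4) p →L[ℝ] ℝ
  lorentz : ∀ p, IsLorentzForm (metric p)
  contMDiff_metric :
    haveI : IsManifold 𝓘(ℝ, R4) 1 carrier := .of_le (n := (k : ℕ∞ω) + 1) le_add_self
    ContMDiff 𝓘(ℝ, R4) (𝓘(ℝ, R4).prod 𝓘(ℝ, R4 →L[ℝ] R4 →L[ℝ] ℝ)) k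
      (fun p ↦ TotalSpace.mk' (R4 →L[ℝ] R4 →L[ℝ] ℝ)
        (E := fun p : carrier ↦
          TangentSpace 𝓘(ℝ, R4) p →L[ℝ] TangentSpace 𝓘(ℝ, R4) p →L[ℝ] ℝ) p (metric p))
  timeField : ∀ p : carrier, TangentSpace 𝓘(ℝ, R4) p
  timelike_timeField : ∀ p, metric p (timeField p) (timeField p) < 0
  continuous_timeField :
    haveI : IsManifold 𝓘(ℝ, R4) 1 carrier := .of_le (n := (k : ℕ∞ω) + 1) le_add_self
    Continuous (fun p ↦ (⟨p, timeField p⟩ : TangentBundle 𝓘(ℝ, R4) carrier))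

namespace Spacetime

attribute [instance] topology t2 secondCountable connected charted manifold

variable {k : ℕ∞}

/-- Future-directed timelike tangent vectors: timelike, and in the same half of the light cone as
the vector field giving the time orientation. -/
def IsFutureTimelike (N : Spacetime k) (p : N.carrier) (v : TangentSpace 𝓘(ℝ, R4) p) : Prop :=
  N.metric p v v < 0 ∧ N.metric p v (N.timeField p) < 0

/-- `γ : [a, b] → N` is a future-directed timelike curve: piecewise `C^1` (for some subdivision
`s 0 = a < s 1 < ⋯ < s n = b`), with future-directed timelike velocity everywhere, including the
one-sided velocities at the endpoints and at the break points. -/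
def IsFutureTimelikeCurve (N : Spacetime k) (γ : ℝ → N.carrier) (a b : ℝ) : Prop :=
  a < b ∧ ∃ (n : ℕ) (s : ℕ → ℝ), s 0 = a ∧ s n = b ∧ ∀ i < n, s i < s (i + 1) ∧
    ContMDiffOn 𝓘(ℝ, ℝ) 𝓘(ℝ, R4) 1 γ (Icc (s i) (s (i + 1))) ∧
    ∀ τ ∈ Icc (s i) (s (i + 1)), N.IsFutureTimelike (γ τ)
      (mfderivWithin 𝓘(ℝ, ℝ) 𝓘(ℝ, R4) γ (Icc (s i) (s (i + 1))) τ (1 : ℝ))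

/-- `N` is a `C^k` extension of the smooth spacetime `S` by means of `φ : S → N`: an isometric
`C^{k+1}` embedding onto a proper open subset, preserving time orientations. (That `φ` is an
immersion is automatic, since it preserves nondegenerate metrics.) -/
structure IsExtension (S : Spacetime ⊤) (N : Spacetime k) (φ : S.carrier → N.carrier) :
    Prop where
  contMDiff : ContMDiff 𝓘(ℝ, R4) 𝓘(ℝ, R4) ((k : ℕ∞ω) + 1) φ
  isOpenEmbedding : IsOpenEmbedding φ
  range_ne_univ : range φ ≠ univ
  isometry : ∀ (p : S.carrier) (v w : TangentSpace 𝓘(ℝ, R4) p),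
    N.metric (φ p) (mfderiv 𝓘(ℝ, R4) 𝓘(ℝ, R4) φ p v) (mfderiv 𝓘(ℝ, R4) 𝓘(ℝ, R4) φ p w)
      = S.metric p v w
  futureTimelike : ∀ (p : S.carrier) (v : TangentSpace 𝓘(ℝ, R4) p),
    S.IsFutureTimelike p v → N.IsFutureTimelike (φ p) (mfderiv 𝓘(ℝ, R4) 𝓘(ℝ, R4) φ p v)

/-- The past boundary of `S` within `N`: the points of the topological boundary of `φ(S)` from
which some future-directed timelike curve runs into `φ(S)`. -/
def pastBoundary (S : Spacetime ⊤) (N : Spacetime k) (φ : S.carrier → N.carrier) :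
    Set N.carrier :=
  {p | p ∈ frontier (range φ) ∧ ∃ (γ : ℝ → N.carrier) (a b : ℝ),
    N.IsFutureTimelikeCurve γ a b ∧ γ a = p ∧ ∀ τ ∈ Ioc a b, γ τ ∈ range φ}

end Spacetime

/-! ### Tensor fields on open subsets of `ℝ⁴` -/

theorem mem_chartAt_source_opens_R4 (U : Opens R4) (x y : U) : y ∈ (chartAt R4 x).source := by
  change y ∈ (OpenPartialHomeomorph.subtypeRestr (chartAt R4 (x : R4)) ⟨x⟩).source
  rw [OpenPartialHomeomorph.subtypeRestr_source]
  exact mem_univ _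

theorem coordChange_opens_R4 (U : Opens R4) (x y z : U) :
    (tangentBundleCore 𝓘(ℝ, R4) U).coordChange (achart R4 x) (achart R4 y) z
      = ContinuousLinearMap.id ℝ R4 := by
  rw [tangentBundleCore_coordChange_achart]
  have hid : (extChartAt 𝓘(ℝ, R4) y ∘ (extChartAt 𝓘(ℝ, R4) x).symm)
      =ᶠ[𝓝 (extChartAt 𝓘(ℝ, R4) x z)] id := by
    have hz : extChartAt 𝓘(ℝ, R4) x z = (z : R4) := rfl
    rw [hz]
    filter_upwards [U.2.mem_nhds z.2] with q hq
    have h1 : extChartAt 𝓘(ℝ, R4) x ⟨q, hq⟩ = q := rfl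
    have h2 : (extChartAt 𝓘(ℝ, R4) x).symm q = ⟨q, hq⟩ := by
      conv_lhs => rw [← h1]
      apply (extChartAt 𝓘(ℝ, R4) x).left_inv
      rw [extChartAt_source]
      exact mem_chartAt_source_opens_R4 U x _
    rw [Function.comp_apply, h2]
    rfl
  rw [modelWithCornersSelf_coe, range_id, fderivWithin_univ, hid.fderiv_eq, fderiv_id]

theorem symmL_opens_R4 (U : Opens R4) (b b' : U) :
    (trivializationAt R4 (TangentSpace 𝓘(ℝ, R4)) b).symmL ℝ b'
      = ContinuousLinearMap.id ℝ R4 := by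
  rw [TangentBundle.symmL_trivializationAt_eq_core, coordChange_opens_R4]
  exact mem_chartAt_source_opens_R4 U b b'

theorem contMDiff_metric_opens (U : Opens R4) {n : ℕ∞ω} (G : R4 → R4 →L[ℝ] R4 →L[ℝ] ℝ)
    (hG : ContDiffOn ℝ n G U)
    (g : ∀ p : U, TangentSpace 𝓘(ℝ, R4) p →L[ℝ] TangentSpace 𝓘(ℝ, R4) p →L[ℝ] ℝ)
    (hg : ∀ p : U, g p = G p) :
    ContMDiff 𝓘(ℝ, R4) (𝓘(ℝ, R4).prod 𝓘(ℝ, R4 →L[ℝ] R4 →L[ℝ] ℝ)) n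
      (fun p : U ↦ TotalSpace.mk' (R4 →L[ℝ] R4 →L[ℝ] ℝ)
        (E := fun p : U ↦
          TangentSpace 𝓘(ℝ, R4) p →L[ℝ] TangentSpace 𝓘(ℝ, R4) p →L[ℝ] ℝ) p (g p)) := by
  intro x
  rw [contMDiffAt_section]
  have hx : ContMDiffAt 𝓘(ℝ, R4) 𝓘(ℝ, R4 →L[ℝ] R4 →L[ℝ] ℝ) n (fun p : U ↦ G p) x :=
    ContMDiffAt.comp (I' := 𝓘(ℝ, R4)) x
      ((hG.contDiffAt (U.2.mem_nhds x.2)).contMDiffAt) contMDiff_subtype_val.contMDiffAt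
  refine hx.congr_of_eventuallyEq (Eventually.of_forall fun y ↦ ?_)
  refine ContinuousLinearMap.ext fun v ↦ ContinuousLinearMap.ext fun w ↦ ?_
  have hy := mem_chartAt_source_opens_R4 U x y
  have hs : ∀ u : R4, (trivializationAt R4 (TangentSpace 𝓘(ℝ, R4)) x).symm y u = u := fun u ↦ by
    have h := DFunLike.congr_fun (symmL_opens_R4 U x y) u
    rwa [Trivialization.symmL_apply (hb := hy)] at h
  beta_reduce
  rw [hom_trivializationAt_apply, inCoordinates_apply_eq₂ hy hy (by simp), hs, hs, hg]
  simp
  rfl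

theorem continuous_vectorField_opens (U : Opens R4) (Y : R4 → R4) (hY : ContinuousOn Y U)
    (X : ∀ p : U, TangentSpace 𝓘(ℝ, R4) p) (hX : ∀ p : U, X p = Y p) :
    Continuous (fun p : U ↦ (⟨p, X p⟩ : TangentBundle 𝓘(ℝ, R4) U)) := by
  rw [continuous_iff_continuousAt]
  intro x
  rw [FiberBundle.continuousAt_totalSpace]
  refine ⟨continuousAt_id, ?_⟩
  have hx : ContinuousAt (fun p : U ↦ Y p) x :=
    (hY.domRestrict).continuousAt
  refine hx.congr (Eventually.of_forall fun y ↦ ?_)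
  have := coordChange_opens_R4 U y x y
  rw [tangentBundleCore_coordChange_achart] at this
  exact ((DFunLike.congr_fun this (X y)).trans (hX y)).symm

/-! ### Flat FLRW spacetimes -/

/-- The data of a flat FLRW spacetime: a nonempty open time interval `I` and a smooth positive
scale factor `a` on it (the values of `a` outside `I` are irrelevant). -/
structure FlatFLRW where
  I : Set ℝ
  isOpen_I : IsOpen I
  ordConnected_I : I.OrdConnected
  nonempty_I : I.Nonempty
  a : ℝ → ℝ
  contDiffOn_a : ContDiffOn ℝ ∞ a I
  a_pos : ∀ t ∈ I, 0 < a t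

namespace FlatFLRW

/-- The manifold `I × ℝ³`, as an open subset of `ℝ⁴ = ℝ × ℝ³`. -/
def domain (F : FlatFLRW) : Opens R4 := ⟨{p | p.1 ∈ F.I}, F.isOpen_I.preimage continuous_fst⟩

/-- The metric `-dt² + a(t)² (dx² + dy² + dz²)` at the point `p = (t, x)`. -/
def metricAt (F : FlatFLRW) (p : R4) : R4 →L[ℝ] R4 →L[ℝ] ℝ :=
  (F.a p.1) ^ 2 • (innerSL ℝ (E := EuclideanSpace ℝ (Fin 3))).bilinearComp
      (ContinuousLinearMap.snd ℝ ℝ _) (ContinuousLinearMap.snd ℝ ℝ _)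
    - (ContinuousLinearMap.mul ℝ ℝ).bilinearComp
      (ContinuousLinearMap.fst ℝ ℝ _) (ContinuousLinearMap.fst ℝ ℝ _)

theorem metricAt_apply (F : FlatFLRW) (p v w : R4) :
    F.metricAt p v w = - (v.1 * w.1) + (F.a p.1) ^ 2 * inner ℝ v.2 w.2 := by
  simp [metricAt, innerSL_apply_apply]; ring

theorem isLorentzForm_metricAt (F : FlatFLRW) (p : R4) (hp : p.1 ∈ F.I) :
    IsLorentzForm (F.metricAt p) := by
  refine ⟨fun v w ↦ ?_, ((1, 0) : R4), ?_, fun w hw hw0 ↦ ?_⟩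
  · simp only [metricAt_apply, real_inner_comm, mul_comm]
  · simp [metricAt_apply]
  · have h1 : w.1 = 0 := by simpa [metricAt_apply] using hw
    have h2 : w.2 ≠ 0 := fun h ↦ hw0 (Prod.ext h1 h)
    have ha := F.a_pos _ hp
    have h3 : 0 < inner ℝ w.2 w.2 := real_inner_self_pos.2 h2
    rw [metricAt_apply, h1]
    simp only [mul_zero, neg_zero, zero_add]
    positivity

theorem contDiff_sq_smul_sub {V : Type*} [NormedAddCommGroup V] [NormedSpace ℝ V] (A B : V) :
    ContDiff ℝ ∞ (fun c : ℝ ↦ c ^ 2 • A - B) := by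
  fun_prop

theorem contDiffOn_metricAt (F : FlatFLRW) : ContDiffOn ℝ ∞ F.metricAt F.domain := by
  have h : ContDiffOn ℝ ∞ (fun p : R4 ↦ F.a p.1) F.domain :=
    F.contDiffOn_a.comp contDiff_fst.contDiffOn (fun p hp ↦ hp)
  exact (contDiff_sq_smul_sub _ _).comp_contDiffOn h

theorem connectedSpace_domain (F : FlatFLRW) : ConnectedSpace F.domain := by
  have h : IsConnected (F.domain : Set R4) := by
    have : (F.domain : Set R4) = F.I ×ˢ univ := by ext p; simp [domain]
    rw [this]
    exact ⟨F.nonempty_I.prod univ_nonempty,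
      F.ordConnected_I.isPreconnected.prod isPreconnected_univ⟩
  exact isConnected_iff_connectedSpace.1 h

/-- The smooth spacetime `(I × ℝ³, -dt² + a(t)² (dx² + dy² + dz²))`, time oriented by `∂_t`. -/
def spacetime (F : FlatFLRW) : Spacetime ⊤ :=
  haveI : ConnectedSpace F.domain := F.connectedSpace_domain
  { carrier := F.domain
    metric := fun p ↦ F.metricAt p
    lorentz := fun p ↦ F.isLorentzForm_metricAt p p.2
    contMDiff_metric := contMDiff_metric_opens F.domain F.metricAt F.contDiffOn_metricAt _
      fun _ ↦ rfl
    timeField := fun _ ↦ ((1, 0) : R4)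
    timelike_timeField := fun p ↦ by
      change F.metricAt p ((1, 0) : R4) ((1, 0) : R4) < 0
      simp [metricAt_apply]
    continuous_timeField :=
      continuous_vectorField_opens F.domain (fun _ ↦ (1, 0)) continuousOn_const _
        fun _ ↦ rfl }

/-- The Hubble parameter `H = ȧ / a`. -/
def hubble (F : FlatFLRW) (t : ℝ) : ℝ := deriv F.a t / F.a t

/-- Past-asymptotically de Sitter: the time interval reaches back to `-∞`, and `H → H_Λ > 0` and
`Ḣ → 0` as `t → -∞`. -/
def IsPastAsymptoticallyDeSitter (F : FlatFLRW) : Prop :=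
  ¬ BddBelow F.I ∧ ∃ HΛ : ℝ, 0 < HΛ ∧
    Tendsto F.hubble atBot (𝓝 HΛ) ∧ Tendsto (deriv F.hubble) atBot (𝓝 0)

end FlatFLRW

end

/-! In the conformal time `η` with `dη = dt / a`, the metric is `a² (-dη² + |dx|²)`, so it is
conformal to a part of Minkowski space. Since `H → H_Λ > 0`, the scale factor behaves to leading
order as in de Sitter space: `1/a → ∞`, `η → -∞` and `a η → -1 / H_Λ` as `t → -∞`. The extension
goes through past null infinity of Minkowski space.

Minkowski space is foliated by the translates `η = v - √(1 + |x|²)` of a hyperboloid, each of which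
is a hyperbolic space; horospherical coordinates `y` with `y 2 > 0` turn it into the upper half
space model. Multiplying the Minkowski metric by `(y 2)²` gives `|dy + b dv|² - m² dv²`, with `m`
and `b` polynomial in `y` and `m > 0`. This form is Lorentzian for every `y`, including `y 2 ≤ 0`
(`completedForm_horoDeriv`, `isLorentzForm_smul_completedForm`).

The FLRW metric is this form times `(a / y 2)²`. Here `η = v - m / y 2`, so as `y 2 → 0⁺` one has `η
→ -∞` and `y 2 * η → -m`; hence `a / y 2 = (a η) / (y 2 * η)` tends to `1 / (H_Λ m)`. This positive
limit is continuous in `y` and serves as the value of the factor for all `y 2 ≤ 0`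
(`continuousAt_conformalFactor_of_eq_zero`). A line crossing `y 2 = 0` in a timelike direction shows
that the past boundary is nonempty. -/

noncomputable section

/-! ### Antiderivatives of reciprocals of asymptotically exponential functions -/

/-- If `b' = -H b` with `H → h > 0` at `-∞` and `b > 0`, then `b → ∞` at `-∞`. -/
theorem tendsto_atTop_of_deriv_eq_neg_mul {b H : ℝ → ℝ} {h T : ℝ} (hh : 0 < h)
    (hb : ∀ t ≤ T, 0 < b t) (hb' : ∀ t ≤ T, HasDerivAt b (-(H t * b t)) t)
    (hH : Tendsto H atBot (𝓝 h)) : Tendsto b atBot atTop := by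
  obtain ⟨S, hS⟩ := eventually_atBot.1 (hH.eventually (lt_mem_nhds (half_lt_self hh)))
  set R := min S T
  -- Where `H > h / 2`, `b` decreases; so `b ≥ b R` to the left of `R`, and then `b' ≤ -k` there,
  -- which forces at least linear growth towards `-∞`.
  have hanti : AntitoneOn b (Iic R) := by
    refine antitoneOn_of_deriv_nonpos (convex_Iic R)
      (fun t ht ↦ (hb' t (ht.trans (min_le_right _ _))).continuousAt.continuousWithinAt)
      (fun t ht ↦ ?_) (fun t ht ↦ ?_) <;> rw [interior_Iic] at ht
    · exact (hb' t (ht.le.trans (min_le_right _ _))).differentiableAt.differentiableWithinAt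
    · rw [(hb' t (ht.le.trans (min_le_right _ _))).deriv]
      have h1 := hS t (ht.le.trans (min_le_left _ _))
      have h2 := hb t (ht.le.trans (min_le_right _ _))
      have : 0 < H t * b t := mul_pos (by linarith) h2
      linarith
  have hbR := hb R (min_le_right _ _)
  set k := h / 2 * b R
  have hk : 0 < k := by positivity
  have hanti2 : AntitoneOn (fun t ↦ b t + k * t) (Iic R) := by
    have hd : ∀ t ≤ R, HasDerivAt (fun t ↦ b t + k * t) (-(H t * b t) + k * 1) t := fun t ht ↦
      (hb' t (ht.trans (min_le_right _ _))).add ((hasDerivAt_id t).const_mul k)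
    refine antitoneOn_of_deriv_nonpos (convex_Iic R)
      (fun t ht ↦ (hd t ht).continuousAt.continuousWithinAt)
      (fun t ht ↦ ?_) (fun t ht ↦ ?_) <;> rw [interior_Iic] at ht
    · exact (hd t ht.le).differentiableAt.differentiableWithinAt
    · rw [(hd t ht.le).deriv]
      have h1 := hS t (ht.le.trans (min_le_left _ _))
      have h2 : b R ≤ b t := hanti (mem_Iic.2 ht.le) self_mem_Iic ht.le
      have : k ≤ H t * b t := mul_le_mul h1.le h2 hbR.le (by linarith)
      linarith
  refine tendsto_atTop_mono' atBot (f₁ := fun t ↦ b R + k * R + k * (-t)) ?_ ?_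
  · filter_upwards [eventually_le_atBot R] with t ht
    have := hanti2 ht self_mem_Iic ht
    simp only at this
    linarith
  · exact tendsto_atTop_add_const_left _ _ (tendsto_neg_atBot_atTop.const_mul_atTop hk)

/-- A form of L'Hôpital's rule: if `η' = b` and `b' = -H b` with `H → h > 0` and `b → ∞` at `-∞`,
then `η / b → -1 / h`. -/
theorem tendsto_div_of_deriv_eq {η b H : ℝ → ℝ} {h T : ℝ} (hh : 0 < h)
    (hb : ∀ t ≤ T, 0 < b t) (hb' : ∀ t ≤ T, HasDerivAt b (-(H t * b t)) t)
    (hη : ∀ t ≤ T, HasDerivAt η (b t) t)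
    (hH : Tendsto H atBot (𝓝 h)) (hbt : Tendsto b atBot atTop) :
    Tendsto (fun t ↦ η t / b t) atBot (𝓝 (-h⁻¹)) := by
  have hd : ∀ c, ∀ t ≤ T, HasDerivAt (fun t ↦ η t + c * b t) (b t * (1 - c * H t)) t :=
    fun c t ht ↦ ((hη t ht).add ((hb' t ht).const_mul c)).congr_deriv (by ring)
  have hlim : ∀ c, Tendsto (fun t ↦ 1 - c * H t) atBot (𝓝 (1 - c * h)) := fun c ↦
    tendsto_const_nhds.sub (hH.const_mul c)
  have hK : ∀ K : ℝ, Tendsto (fun t ↦ K / b t) atBot (𝓝 0) := fun K ↦ hbt.const_div_atTop K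
  refine tendsto_order.2 ⟨fun l hl ↦ ?_, fun l hl ↦ ?_⟩
  -- The derivative of `η + c b` is `b (1 - c H)`, whose sign near `-∞` is that of `1 - c h`.
  -- Monotonicity compares `η + c b` with its value `K` at `R`, and `K / b → 0`, so `-c` bounds `η /
  -- b` asymptotically. Any `c` strictly between `h⁻¹` and `-l` serves, here and for the upper
  -- bound.
  · obtain ⟨c, hc1, hc2⟩ := exists_between (lt_neg_of_lt_neg hl)
    have hch : 1 - c * h < 0 := by
      have := mul_lt_mul_of_pos_right hc1 hh
      rw [inv_mul_cancel₀ hh.ne'] at this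
      linarith
    obtain ⟨S, hS⟩ := eventually_atBot.1 ((hlim c).eventually (gt_mem_nhds hch))
    set R := min S T
    have hanti : AntitoneOn (fun t ↦ η t + c * b t) (Iic R) := by
      refine antitoneOn_of_deriv_nonpos (convex_Iic R) (fun t ht ↦
          (hd c t (ht.trans (min_le_right _ _))).continuousAt.continuousWithinAt)
        (fun t ht ↦ ?_) (fun t ht ↦ ?_) <;> rw [interior_Iic] at ht
      · exact (hd c t (ht.le.trans (min_le_right _ _))).differentiableAt.differentiableWithinAt
      · rw [(hd c t (ht.le.trans (min_le_right _ _))).deriv]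
        exact mul_nonpos_of_nonneg_of_nonpos (hb t (ht.le.trans (min_le_right _ _))).le
          (hS t (ht.le.trans (min_le_left _ _))).le
    filter_upwards [eventually_le_atBot R, (hK (η R + c * b R)).eventually
      (lt_mem_nhds (show l + c < 0 by linarith))] with t ht h2
    have h1 : η R + c * b R ≤ η t + c * b t := hanti ht self_mem_Iic ht
    have hbp := hb t (ht.trans (min_le_right _ _))
    rw [lt_div_iff₀ hbp] at h2 ⊢
    linarith
  · obtain ⟨c, hc1, hc2⟩ := exists_between (neg_lt_of_neg_lt hl)
    have hch : 0 < 1 - c * h := by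
      have := mul_lt_mul_of_pos_right hc2 hh
      rw [inv_mul_cancel₀ hh.ne'] at this
      linarith
    obtain ⟨S, hS⟩ := eventually_atBot.1 ((hlim c).eventually (lt_mem_nhds hch))
    set R := min S T
    have hmono : MonotoneOn (fun t ↦ η t + c * b t) (Iic R) := by
      refine monotoneOn_of_deriv_nonneg (convex_Iic R) (fun t ht ↦
          (hd c t (ht.trans (min_le_right _ _))).continuousAt.continuousWithinAt)
        (fun t ht ↦ ?_) (fun t ht ↦ ?_) <;> rw [interior_Iic] at ht
      · exact (hd c t (ht.le.trans (min_le_right _ _))).differentiableAt.differentiableWithinAt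
      · rw [(hd c t (ht.le.trans (min_le_right _ _))).deriv]
        exact mul_nonneg (hb t (ht.le.trans (min_le_right _ _))).le
          (hS t (ht.le.trans (min_le_left _ _))).le
    filter_upwards [eventually_le_atBot R, (hK (η R + c * b R)).eventually
      (gt_mem_nhds (show 0 < l + c by linarith))] with t ht h2
    have h1 : η t + c * b t ≤ η R + c * b R := hmono ht self_mem_Iic ht
    have hbp := hb t (ht.trans (min_le_right _ _))
    rw [div_lt_iff₀ hbp] at h2 ⊢
    linarith

/-! ### Conformal time and its inverse -/

namespace FlatFLRW

/-- A base point of the time interval. -/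
def baseTime (F : FlatFLRW) : ℝ := F.nonempty_I.some

theorem baseTime_mem (F : FlatFLRW) : F.baseTime ∈ F.I := F.nonempty_I.some_mem

/-- The conformal time `η`, with `dη = dt / a`. -/
def conformalTime (F : FlatFLRW) (t : ℝ) : ℝ := ∫ r in F.baseTime..t, (F.a r)⁻¹

theorem continuousOn_inv_a (F : FlatFLRW) : ContinuousOn (fun t ↦ (F.a t)⁻¹) F.I :=
  F.contDiffOn_a.continuousOn.inv₀ fun t ht ↦ (F.a_pos t ht).ne'

theorem hasDerivAt_conformalTime (F : FlatFLRW) {t : ℝ} (ht : t ∈ F.I) :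
    HasDerivAt F.conformalTime (F.a t)⁻¹ t := by
  have hI := F.ordConnected_I
  refine intervalIntegral.integral_hasDerivAt_right
    (F.continuousOn_inv_a.mono (hI.uIcc_subset F.baseTime_mem ht)).intervalIntegrable
    (F.continuousOn_inv_a.stronglyMeasurableAtFilter F.isOpen_I t ht)
    (F.continuousOn_inv_a.continuousAt (F.isOpen_I.mem_nhds ht))

theorem contDiffOn_conformalTime (F : FlatFLRW) : ContDiffOn ℝ 1 F.conformalTime F.I := by
  rw [show (1 : ℕ∞ω) = 0 + 1 from rfl, contDiffOn_succ_iff_deriv_of_isOpen F.isOpen_I]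
  refine ⟨fun t ht ↦ (F.hasDerivAt_conformalTime ht).differentiableAt.differentiableWithinAt,
    by simp, contDiffOn_zero.2 ?_⟩
  exact F.continuousOn_inv_a.congr fun t ht ↦ (F.hasDerivAt_conformalTime ht).deriv

theorem strictMonoOn_conformalTime (F : FlatFLRW) : StrictMonoOn F.conformalTime F.I := by
  refine strictMonoOn_of_deriv_pos F.ordConnected_I.convex F.contDiffOn_conformalTime.continuousOn
    fun t ht ↦ ?_
  rw [(F.hasDerivAt_conformalTime (interior_subset ht)).deriv]
  exact inv_pos.2 (F.a_pos t (interior_subset ht))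

/-- The range of the conformal time. -/
def conformalRange (F : FlatFLRW) : Set ℝ := F.conformalTime '' F.I

theorem ordConnected_conformalRange (F : FlatFLRW) : F.conformalRange.OrdConnected :=
  (F.ordConnected_I.isPreconnected.image _ F.contDiffOn_conformalTime.continuousOn).ordConnected

/-- An interior time lies strictly between two others of `I`; by strict monotonicity the interval
between their images is a neighbourhood, and the range is order connected. -/
theorem isOpen_conformalRange (F : FlatFLRW) : IsOpen F.conformalRange := by
  rw [isOpen_iff_mem_nhds]
  rintro _ ⟨t, ht, rfl⟩
  obtain ⟨l, u, hlu, hsub⟩ := mem_nhds_iff_exists_Ioo_subset.1 (F.isOpen_I.mem_nhds ht)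
  obtain ⟨t₁, h1, h1'⟩ := exists_between hlu.1
  obtain ⟨t₂, h2, h2'⟩ := exists_between hlu.2
  have m1 : t₁ ∈ F.I := hsub ⟨h1, h1'.trans hlu.2⟩
  have m2 : t₂ ∈ F.I := hsub ⟨hlu.1.trans h2, h2'⟩
  exact mem_of_superset (Icc_mem_nhds (F.strictMonoOn_conformalTime m1 ht h1')
    (F.strictMonoOn_conformalTime ht m2 h2))
    (F.ordConnected_conformalRange.out (mem_image_of_mem _ m1) (mem_image_of_mem _ m2))

/-- The time as a function of the conformal time. -/
def timeOf (F : FlatFLRW) : ℝ → ℝ := Function.invFunOn F.conformalTime F.I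

theorem timeOf_mem (F : FlatFLRW) {e : ℝ} (he : e ∈ F.conformalRange) : F.timeOf e ∈ F.I :=
  Function.invFunOn_mem he

theorem conformalTime_timeOf (F : FlatFLRW) {e : ℝ} (he : e ∈ F.conformalRange) :
    F.conformalTime (F.timeOf e) = e :=
  Function.invFunOn_eq he

theorem timeOf_conformalTime (F : FlatFLRW) {t : ℝ} (ht : t ∈ F.I) :
    F.timeOf (F.conformalTime t) = t :=
  F.strictMonoOn_conformalTime.injOn.leftInvOn_invFunOn ht

theorem strictMonoOn_timeOf (F : FlatFLRW) : StrictMonoOn F.timeOf F.conformalRange := by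
  rintro _ ⟨t, ht, rfl⟩ _ ⟨u, hu, rfl⟩ h
  rw [F.timeOf_conformalTime ht, F.timeOf_conformalTime hu]
  exact (F.strictMonoOn_conformalTime.lt_iff_lt ht hu).1 h

theorem image_timeOf (F : FlatFLRW) : F.timeOf '' F.conformalRange = F.I := by
  ext t
  constructor
  · rintro ⟨e, he, rfl⟩
    exact F.timeOf_mem he
  · exact fun ht ↦ ⟨_, mem_image_of_mem _ ht, F.timeOf_conformalTime ht⟩

theorem continuousOn_timeOf (F : FlatFLRW) : ContinuousOn F.timeOf F.conformalRange := by
  intro e he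
  refine (F.strictMonoOn_timeOf.continuousAt_of_image_mem_nhds
    (F.isOpen_conformalRange.mem_nhds he) ?_).continuousWithinAt
  rw [image_timeOf]
  exact F.isOpen_I.mem_nhds (F.timeOf_mem he)

/-- The scale factor as a function of the conformal time. -/
def conformalScale (F : FlatFLRW) (e : ℝ) : ℝ := F.a (F.timeOf e)

theorem conformalScale_pos (F : FlatFLRW) {e : ℝ} (he : e ∈ F.conformalRange) :
    0 < F.conformalScale e :=
  F.a_pos _ (F.timeOf_mem he)

theorem continuousOn_conformalScale (F : FlatFLRW) :
    ContinuousOn F.conformalScale F.conformalRange :=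
  F.contDiffOn_a.continuousOn.comp F.continuousOn_timeOf fun _ ↦ F.timeOf_mem

/-! ### Asymptotics of the scale factor in conformal time -/

section AsymptoticallyDeSitter

variable {F : FlatFLRW} {h : ℝ}

theorem Iic_subset_of_not_bddBelow (hI : ¬ BddBelow F.I) {t : ℝ} (ht : t ∈ F.I) :
    Iic t ⊆ F.I := by
  intro u hu
  obtain ⟨w, hw, hwu⟩ := not_bddBelow_iff.1 hI u
  exact F.ordConnected_I.out hw ht ⟨hwu.le, hu⟩

theorem hasDerivAt_inv_a (F : FlatFLRW) {t : ℝ} (ht : t ∈ F.I) :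
    HasDerivAt (fun t ↦ (F.a t)⁻¹) (-(F.hubble t * (F.a t)⁻¹)) t := by
  have h0 := (F.a_pos t ht).ne'
  have h1 : HasDerivAt F.a (deriv F.a t) t :=
    ((F.contDiffOn_a.contDiffAt (F.isOpen_I.mem_nhds ht)).differentiableAt (by simp)).hasDerivAt
  refine (h1.inv h0).congr_deriv ?_
  rw [hubble]
  field_simp

theorem tendsto_inv_a (hI : ¬ BddBelow F.I) (hh : 0 < h)
    (hH : Tendsto F.hubble atBot (𝓝 h)) : Tendsto (fun t ↦ (F.a t)⁻¹) atBot atTop :=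
  have hsub := Iic_subset_of_not_bddBelow hI F.baseTime_mem
  tendsto_atTop_of_deriv_eq_neg_mul hh (fun t ht ↦ inv_pos.2 (F.a_pos t (hsub ht)))
    (fun _ ht ↦ F.hasDerivAt_inv_a (hsub ht)) hH

/-- L'Hôpital for `η / a⁻¹`: the derivative of `η` is `a⁻¹`, and that of `a⁻¹` is `-H a⁻¹`. -/
theorem tendsto_mul_conformalTime (hI : ¬ BddBelow F.I) (hh : 0 < h)
    (hH : Tendsto F.hubble atBot (𝓝 h)) :
    Tendsto (fun t ↦ F.a t * F.conformalTime t) atBot (𝓝 (-h⁻¹)) := by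
  have hsub := Iic_subset_of_not_bddBelow hI F.baseTime_mem
  have := tendsto_div_of_deriv_eq hh (fun t ht ↦ inv_pos.2 (F.a_pos t (hsub ht)))
    (fun _ ht ↦ F.hasDerivAt_inv_a (hsub ht))
    (fun _ ht ↦ F.hasDerivAt_conformalTime (hsub ht)) hH (tendsto_inv_a hI hh hH)
  refine this.congr fun t ↦ ?_
  rw [div_inv_eq_mul, mul_comm]

/-- `η = a⁻¹ * (a η)`, where the first factor tends to `∞` and the second to a negative number. -/
theorem tendsto_conformalTime (hI : ¬ BddBelow F.I) (hh : 0 < h)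
    (hH : Tendsto F.hubble atBot (𝓝 h)) : Tendsto F.conformalTime atBot atBot := by
  have hsub := Iic_subset_of_not_bddBelow hI F.baseTime_mem
  refine ((tendsto_inv_a hI hh hH).atTop_mul_neg (by simpa using hh)
    (tendsto_mul_conformalTime hI hh hH)).congr' ?_
  filter_upwards [eventually_le_atBot F.baseTime] with t ht
  rw [inv_mul_cancel_left₀ (F.a_pos t (hsub ht)).ne']

theorem Iic_subset_conformalRange (hI : ¬ BddBelow F.I) (hh : 0 < h)
    (hH : Tendsto F.hubble atBot (𝓝 h)) {e : ℝ} (he : e ∈ F.conformalRange) :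
    Iic e ⊆ F.conformalRange := by
  intro u hu
  have hsub := Iic_subset_of_not_bddBelow hI F.baseTime_mem
  obtain ⟨t, ht1, ht2⟩ := (((tendsto_conformalTime hI hh hH).eventually
    (eventually_le_atBot u)).and (eventually_le_atBot F.baseTime)).exists
  exact F.ordConnected_conformalRange.out (mem_image_of_mem _ (hsub ht2)) he ⟨ht1, hu⟩

theorem tendsto_timeOf (hI : ¬ BddBelow F.I) (hh : 0 < h)
    (hH : Tendsto F.hubble atBot (𝓝 h)) : Tendsto F.timeOf atBot atBot := by
  have hsub := Iic_subset_of_not_bddBelow hI F.baseTime_mem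
  refine tendsto_atBot.2 fun t ↦ ?_
  have hm : min t F.baseTime ∈ F.I := hsub (mem_Iic.2 (min_le_right _ _))
  filter_upwards [eventually_le_atBot (F.conformalTime (min t F.baseTime))] with e he
  have h1 := Iic_subset_conformalRange hI hh hH (mem_image_of_mem _ hm) he
  have := (F.strictMonoOn_timeOf.monotoneOn h1 (mem_image_of_mem _ hm) he)
  rw [F.timeOf_conformalTime hm] at this
  exact this.trans (min_le_left _ _)

/-- The only asymptotic information on `a` that enters the limit of the conformal factor; in exact
de Sitter space one has `a = -1 / (h η)`. -/
theorem tendsto_conformalScale_mul (hI : ¬ BddBelow F.I) (hh : 0 < h)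
    (hH : Tendsto F.hubble atBot (𝓝 h)) :
    Tendsto (fun e ↦ F.conformalScale e * e) atBot (𝓝 (-h⁻¹)) := by
  refine ((tendsto_mul_conformalTime hI hh hH).comp (tendsto_timeOf hI hh hH)).congr' ?_
  filter_upwards [eventually_le_atBot (F.conformalTime F.baseTime)] with e he
  rw [Function.comp_apply, F.conformalTime_timeOf
    (Iic_subset_conformalRange hI hh hH (mem_image_of_mem _ F.baseTime_mem) he), conformalScale]

end AsymptoticallyDeSitter

end FlatFLRW

/-! ### Maps between open subsets of `ℝ⁴` -/

theorem contMDiffWithinAt_subtypeVal_comp_iff {E M : Type*} [NormedAddCommGroup E]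
    [NormedSpace ℝ E] [TopologicalSpace M] [ChartedSpace E M] {n : ℕ∞ω} (U : Opens R4) (f : M → U)
    (s : Set M) (x : M) :
    ContMDiffWithinAt 𝓘(ℝ, E) 𝓘(ℝ, R4) n (Subtype.val ∘ f) s x ↔
      ContMDiffWithinAt 𝓘(ℝ, E) 𝓘(ℝ, R4) n f s x :=
  ChartedSpace.liftPropWithinAt_subtypeVal_comp_iff ..

theorem mul_neg_iff_of_pos {c x : ℝ} (hc : 0 < c) : c * x < 0 ↔ x < 0 := by
  rw [← neg_pos, ← mul_neg, mul_pos_iff_of_pos_left hc, neg_pos]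

/-- The charts of an open subset of `ℝ⁴` are restrictions of the identity, so manifold derivatives
are ordinary derivatives. -/
theorem hasMFDerivAt_opens {U V : Opens R4} {f : U → V} {Φ : R4 → R4} (hf : ∀ p, (f p : R4) = Φ p)
    {p : U} {L : R4 →L[ℝ] R4} (hΦ : HasFDerivAt Φ L (p : R4)) :
    HasMFDerivAt 𝓘(ℝ, R4) 𝓘(ℝ, R4) f p L := by
  refine ⟨?_, ?_⟩
  · rw [ContinuousAt, nhds_induced _ (f p), tendsto_comap_iff, hf p]
    exact (hΦ.continuousAt.comp continuous_subtype_val.continuousAt).tendsto.congr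
      fun q ↦ (hf q).symm
  · refine (HasFDerivAt.congr_of_eventuallyEq (f := Φ) hΦ ?_).hasFDerivWithinAt
    filter_upwards [U.2.mem_nhds p.2] with q hq
    have h2 : (extChartAt 𝓘(ℝ, R4) p).symm q = ⟨q, hq⟩ :=
      (extChartAt 𝓘(ℝ, R4) p).left_inv (x := ⟨q, hq⟩)
        (by rw [extChartAt_source]; exact mem_chartAt_source_opens_R4 U p _)
    change ((f ((extChartAt 𝓘(ℝ, R4) p).symm q) : V) : R4) = Φ q
    rw [h2, hf]

theorem hasMFDerivWithinAt_curve_opens {V : Opens R4} {γ : ℝ → V} {c : ℝ → R4} {s : Set ℝ}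
    (hγ : ∀ τ ∈ s, (γ τ : R4) = c τ) {τ : ℝ} (hτ : τ ∈ s) {L : ℝ →L[ℝ] R4}
    (hc : HasFDerivAt c L τ) :
    HasMFDerivWithinAt 𝓘(ℝ, ℝ) 𝓘(ℝ, R4) γ s τ L := by
  refine ⟨?_, ?_⟩
  · rw [ContinuousWithinAt, nhds_induced, tendsto_comap_iff, hγ τ hτ]
    exact Tendsto.congr' (eventually_mem_nhdsWithin.mono fun q hq ↦ (hγ q hq).symm)
      hc.continuousAt.continuousWithinAt
  · refine HasFDerivWithinAt.congr (f := c) hc.hasFDerivWithinAt (fun q hq ↦ ?_) ?_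
    · exact hγ q hq.1
    · exact hγ τ hτ

/-! ### Horospherical coordinates on `ℝ³` and the conformal completion of Minkowski space -/

/-- Euclidean three-space. -/
abbrev E3 : Type := EuclideanSpace ℝ (Fin 3)

theorem E3.inner_eq (x y : E3) : inner ℝ x y = x 0 * y 0 + x 1 * y 1 + x 2 * y 2 := by
  simp [PiLp.inner_apply, Fin.sum_univ_three, mul_comm]

theorem E3.norm_sq_eq (x : E3) : ‖x‖ ^ 2 = x 0 ^ 2 + x 1 ^ 2 + x 2 ^ 2 := by
  rw [← real_inner_self_eq_norm_sq, E3.inner_eq]; ring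

theorem E3.ext {x y : E3} (h0 : x 0 = y 0) (h1 : x 1 = y 1) (h2 : x 2 = y 2) : x = y := by
  ext i; fin_cases i <;> assumption

/-- The third basis vector of `ℝ³`. -/
def axis : E3 := EuclideanSpace.single 2 1

@[simp] theorem axis_zero : axis 0 = 0 := by simp [axis]
@[simp] theorem axis_one : axis 1 = 0 := by simp [axis]
@[simp] theorem axis_two : axis 2 = 1 := by simp [axis]

/-- The height `√(1 + |x|²)` of the hyperboloid over `x`. -/
def height (x : E3) : ℝ := √(1 + ‖x‖ ^ 2)

theorem height_sq (x : E3) : height x ^ 2 = 1 + ‖x‖ ^ 2 := Real.sq_sqrt (by positivity)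

theorem height_pos (x : E3) : 0 < height x := Real.sqrt_pos.2 (by positivity)

theorem norm_le_height (x : E3) : ‖x‖ ≤ height x :=
  Real.le_sqrt_of_sq_le (by linarith)

/-- The product of `height x + x 2` and `height x - x 2` is `1 + x₀² + x₁² > 0`, and their sum is
positive. -/
theorem height_add_pos (x : E3) : 0 < height x + x 2 := by
  have h1 := height_sq x
  rw [E3.norm_sq_eq] at h1
  nlinarith [height_pos x, sq_nonneg (x 0), sq_nonneg (x 1)]

theorem hasFDerivAt_height (x : E3) :
    HasFDerivAt height ((height x)⁻¹ • innerSL ℝ x) x := by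
  have h := ((hasFDerivAt_id x).norm_sq.const_add 1).sqrt (by positivity)
  refine h.congr_fderiv (ContinuousLinearMap.ext fun v ↦ ?_)
  simp [height]
  field_simp

theorem contDiff_height : ContDiff ℝ ∞ height :=
  (contDiff_const.add (contDiff_norm_sq ℝ)).sqrt fun x ↦ by positivity

/-- Horospherical coordinates of `ℝ³`, identified with the hyperboloid over it. The image is the
upper half space. -/
def horo (x : E3) : E3 := (height x + x 2)⁻¹ • (x + (1 - x 2) • axis)

theorem horo_zero (x : E3) : horo x 0 = (height x + x 2)⁻¹ * x 0 := by simp [horo]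
theorem horo_one (x : E3) : horo x 1 = (height x + x 2)⁻¹ * x 1 := by simp [horo]
-- The summand `(1 - x 2) • axis` in `horo` replaces the third component of `x` by `1`.
theorem horo_two (x : E3) : horo x 2 = (height x + x 2)⁻¹ := by
  simp [horo]; ring

theorem horo_two_pos (x : E3) : 0 < horo x 2 := by
  rw [horo_two]; exact inv_pos.2 (height_add_pos x)

/-- The function `(1 + |y|²) / 2`. -/
def lapse (y : E3) : ℝ := (1 + ‖y‖ ^ 2) / 2

theorem lapse_pos (y : E3) : 0 < lapse y := by unfold lapse; positivity

/-- The height on the hyperboloid, in half space coordinates, is `(1 + |y|²) / (2 y₂)`. Consequently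
`lapse / y 2` is the amount by which `v` exceeds `η`. -/
theorem lapse_horo (x : E3) : lapse (horo x) = height x * horo x 2 := by
  have h1 := height_sq x
  have h2 := (height_add_pos x).ne'
  rw [E3.norm_sq_eq] at h1
  rw [lapse, E3.norm_sq_eq, horo_zero, horo_one, horo_two]
  field_simp
  linear_combination -h1

/-- The inverse of the horospherical coordinates. -/
def horoInv (y : E3) : E3 := (y 2)⁻¹ • (y + (1 - lapse y - y 2) • axis)

theorem horoInv_horo (x : E3) : horoInv (horo x) = x := by
  have h1 := height_sq x
  have h2 := (height_add_pos x).ne'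
  rw [E3.norm_sq_eq] at h1
  apply E3.ext <;> simp only [horoInv, lapse_horo, PiLp.smul_apply, PiLp.add_apply, smul_eq_mul,
    axis_zero, axis_one, axis_two, horo_zero, horo_one, horo_two] <;> field_simp <;> ring

theorem height_horoInv {y : E3} (hy : 0 < y 2) : height (horoInv y) = lapse y / y 2 := by
  refine (Real.sqrt_eq_iff_eq_sq (by positivity) (div_pos (lapse_pos y) hy).le).2 ?_
  rw [E3.norm_sq_eq]
  simp only [horoInv, lapse, E3.norm_sq_eq, PiLp.smul_apply, PiLp.add_apply, smul_eq_mul,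
    axis_zero, axis_one, axis_two]
  field_simp
  ring

theorem horo_horoInv {y : E3} (hy : 0 < y 2) : horo (horoInv y) = y := by
  have h : (height (horoInv y) + horoInv y 2)⁻¹ = y 2 := by
    rw [height_horoInv hy]
    simp only [horoInv, PiLp.smul_apply, PiLp.add_apply, smul_eq_mul, axis_two]
    field_simp
    ring
  apply E3.ext
  · rw [horo_zero, h]; simp [horoInv, hy.ne']
  · rw [horo_one, h]; simp [horoInv, hy.ne']
  · rw [horo_two, h]

theorem contDiff_coord (i : Fin 3) : ContDiff ℝ ∞ (fun x : E3 ↦ x i) :=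
  (EuclideanSpace.proj (𝕜 := ℝ) i : E3 →L[ℝ] ℝ).contDiff

theorem continuous_lapse : Continuous lapse := by unfold lapse; fun_prop

theorem contDiff_horo : ContDiff ℝ ∞ horo := by
  have h := contDiff_coord 2
  exact ((contDiff_height.add h).inv fun x ↦ (height_add_pos x).ne').smul
    (contDiff_id.add ((contDiff_const.sub h).smul contDiff_const))

theorem continuousOn_horoInv : ContinuousOn horoInv {y | 0 < y 2} := by
  have h := (contDiff_coord 2).continuous
  exact (h.continuousOn.inv₀ fun y hy ↦ ne_of_gt hy).smul (Continuous.continuousOn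
    (continuous_id.add (((continuous_const.sub continuous_lapse).sub h).smul continuous_const)))

/-- The derivative of the horospherical coordinates at `x`. -/
def horoDeriv (x : E3) : E3 →L[ℝ] E3 :=
  (height x + x 2)⁻¹ • (ContinuousLinearMap.id ℝ E3
      - (EuclideanSpace.proj (𝕜 := ℝ) (2 : Fin 3) : E3 →L[ℝ] ℝ).smulRight axis
      - ((height x)⁻¹ • innerSL ℝ x + EuclideanSpace.proj (𝕜 := ℝ) (2 : Fin 3)).smulRight (horo x))

theorem horoDeriv_apply (x ξ : E3) : horoDeriv x ξ = (height x + x 2)⁻¹ •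
    (ξ - ξ 2 • axis - ((height x)⁻¹ * inner ℝ x ξ + ξ 2) • horo x) := by
  simp [horoDeriv]

theorem hasFDerivAt_horo (x : E3) : HasFDerivAt horo (horoDeriv x) x := by
  have hp : HasFDerivAt (fun x : E3 ↦ x 2)
    (EuclideanSpace.proj (𝕜 := ℝ) (2 : Fin 3) : E3 →L[ℝ] ℝ) x :=
    (EuclideanSpace.proj (𝕜 := ℝ) (2 : Fin 3) : E3 →L[ℝ] ℝ).hasFDerivAt
  have hi : HasFDerivAt (fun x : E3 ↦ (height x + x 2)⁻¹) _ x :=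
    (hasDerivAt_inv (height_add_pos x).ne').comp_hasFDerivAt x ((hasFDerivAt_height x).add hp)
  have h := hi.smul
    ((hasFDerivAt_id x).add ((hp.const_sub 1).smul_const axis))
  refine h.congr_fderiv (ContinuousLinearMap.ext fun v ↦ ?_)
  have h2 := (height_add_pos x).ne'
  have h3 := (height_pos x).ne'
  rw [horoDeriv_apply]
  apply E3.ext <;> simp [horo] <;> field_simp <;> ring

/-! ### The rescaled Minkowski metric in half space coordinates -/

/-- The shift vector field of the completed metric. -/
def shift (y : E3) : E3 := y 2 • y - lapse y • axis

/-- The metric `-m² dv² + |dy + b dv|²` at the point `(v, y)`, where `m` is the lapse and `b` the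
shift. It is conformal to the Minkowski metric, with `y 2 = 0` being past null infinity. -/
def completedForm (y : E3) : R4 →L[ℝ] R4 →L[ℝ] ℝ :=
  (innerSL ℝ (E := E3)).bilinearComp
      (ContinuousLinearMap.snd ℝ ℝ E3 + (ContinuousLinearMap.fst ℝ ℝ E3).smulRight (shift y))
      (ContinuousLinearMap.snd ℝ ℝ E3 + (ContinuousLinearMap.fst ℝ ℝ E3).smulRight (shift y))
    - lapse y ^ 2 • (ContinuousLinearMap.mul ℝ ℝ).bilinearComp
      (ContinuousLinearMap.fst ℝ ℝ _) (ContinuousLinearMap.fst ℝ ℝ _)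

theorem completedForm_apply (y : E3) (v w : R4) : completedForm y v w
    = inner ℝ (v.2 + v.1 • shift y) (w.2 + w.1 • shift y) - lapse y ^ 2 * (v.1 * w.1) := by
  simp only [completedForm, sub_apply, smul_apply, add_apply,
    ContinuousLinearMap.bilinearComp_apply, innerSL_apply_apply, ContinuousLinearMap.coe_fst',
    ContinuousLinearMap.coe_snd', ContinuousLinearMap.smulRight_apply,
    ContinuousLinearMap.mul_apply', smul_eq_mul]

theorem continuous_shift : Continuous shift :=
  ((contDiff_coord 2).continuous.smul continuous_id).sub (continuous_lapse.smul continuous_const)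

theorem continuous_completedForm : Continuous completedForm := by
  rw [continuous_clm_apply]
  intro v
  rw [continuous_clm_apply]
  intro w
  simp only [completedForm_apply]
  have := continuous_shift
  have := continuous_lapse
  fun_prop

/-- The vector dual to the lapse form; it is timelike for the completed metric. -/
def normalVector (y : E3) : R4 := (1, -shift y)

theorem completedForm_normalVector (y : E3) (v : R4) :
    completedForm y v (normalVector y) = -(lapse y ^ 2 * v.1) := by
  simp [completedForm_apply, normalVector]

theorem completedForm_comm (y : E3) (v w : R4) :
    completedForm y v w = completedForm y w v := by
  rw [completedForm_apply, completedForm_apply, real_inner_comm, mul_comm v.1]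

/-- The orthogonal complement of `normalVector y` is the kernel of `dv`, on which the form is `c
|dy|²`. No sign of `y 2` is involved. -/
theorem isLorentzForm_smul_completedForm {c : ℝ} (hc : 0 < c) (y : E3) :
    IsLorentzForm (c • completedForm y) := by
  have hl := lapse_pos y
  refine ⟨fun v w ↦ ?_, normalVector y, ?_, fun w hw hw0 ↦ ?_⟩
  · simp [completedForm_comm y v w]
  · simp only [smul_apply, completedForm_normalVector, smul_eq_mul]
    have : (normalVector y).1 = 1 := rfl
    rw [this, mul_neg, neg_lt_zero]
    positivity
  · simp only [smul_apply, completedForm_comm y _ w,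
      completedForm_normalVector, smul_eq_mul] at hw
    have h1 : w.1 = 0 := by simpa [hc.ne', hl.ne'] using hw
    have h2 : w.2 ≠ 0 := fun h ↦ hw0 (Prod.ext h1 h)
    have h3 : 0 < inner ℝ w.2 w.2 := real_inner_self_pos.2 h2
    simp only [smul_apply, completedForm_apply, h1, smul_eq_mul, zero_smul,
      add_zero, mul_zero, sub_zero]
    positivity

/-- The algebra behind `completedForm_horoDeriv`, divided by `(y 2)²`: `r` is the height, `s = r + x
2 = 1 / y 2`, `a` and `b` are spatial vectors, `P` and `Q` the derivatives of the height along them,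
and `h` is the equation of the hyperboloid. Once `P` and `Q` are eliminated, the two sides differ by
a multiple of `h`. -/
theorem horo_polynomial_identity {r s x0 x1 p q P Q a0 a1 a2 b0 b1 b2 : ℝ} (hs : s ≠ 0)
    (h : s ^ 2 + 1 + x0 ^ 2 + x1 ^ 2 = 2 * r * s)
    (hP : r * P = x0 * a0 + x1 * a1 + (s - r) * a2)
    (hQ : r * Q = x0 * b0 + x1 * b1 + (s - r) * b2) :
    (a0 + (p - a2) * (x0 / s)) * (b0 + (q - b2) * (x0 / s))
      + (a1 + (p - a2) * (x1 / s)) * (b1 + (q - b2) * (x1 / s))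
      + ((p - a2) / s - r * (p + P)) * ((q - b2) / s - r * (q + Q))
      - r ^ 2 * ((p + P) * (q + Q)) = -(p * q) + (a0 * b0 + a1 * b1 + a2 * b2) := by
  have e1 : r * (p + P) = r * p + (x0 * a0 + x1 * a1 + (s - r) * a2) := by rw [← hP]; ring
  have e2 : r * (q + Q) = r * q + (x0 * b0 + x1 * b1 + (s - r) * b2) := by rw [← hQ]; ring
  rw [show r ^ 2 * ((p + P) * (q + Q)) = (r * (p + P)) * (r * (q + Q)) by ring, e1, e2]
  field_simp
  linear_combination (p - a2) * (q - b2) * h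

/-- The horospherical coordinates pull back the completed metric to a multiple of the Minkowski
metric. -/
theorem completedForm_horoDeriv (x ξ ζ : E3) (p q : ℝ) :
    completedForm (horo x) (p + (height x)⁻¹ * inner ℝ x ξ, horoDeriv x ξ)
      (q + (height x)⁻¹ * inner ℝ x ζ, horoDeriv x ζ)
      = horo x 2 ^ 2 * (-(p * q) + inner ℝ ξ ζ) := by
  have h1 := height_sq x
  have h2 := (height_add_pos x).ne'
  have h3 := (height_pos x).ne'
  rw [E3.norm_sq_eq] at h1
  simp only [completedForm_apply, shift, lapse_horo, horoDeriv_apply, E3.inner_eq, PiLp.add_apply,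
    PiLp.smul_apply, PiLp.sub_apply, smul_eq_mul, horo_zero, horo_one, horo_two, axis_zero,
    axis_one, axis_two]
  have hP : height x * ((height x)⁻¹ * (x 0 * ξ 0 + x 1 * ξ 1 + x 2 * ξ 2))
      = x 0 * ξ 0 + x 1 * ξ 1 + (height x + x 2 - height x) * ξ 2 := by
    field_simp; ring
  have hQ : height x * ((height x)⁻¹ * (x 0 * ζ 0 + x 1 * ζ 1 + x 2 * ζ 2))
      = x 0 * ζ 0 + x 1 * ζ 1 + (height x + x 2 - height x) * ζ 2 := by
    field_simp; ring
  rw [← horo_polynomial_identity (p := p) (q := q) h2 (by linear_combination -h1) hP hQ]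
  generalize (height x)⁻¹ * (x 0 * ξ 0 + x 1 * ξ 1 + x 2 * ξ 2) = P
  generalize (height x)⁻¹ * (x 0 * ζ 0 + x 1 * ζ 1 + x 2 * ζ 2) = Q
  ring

/-! ### The extended region, the conformal factor and the extended spacetime -/

namespace FlatFLRW

variable {F : FlatFLRW} {h : ℝ}

/-- The region of `ℝ⁴` on which the extended metric is defined: the half space `y 2 ≤ 0` together
with the image of the spacetime. -/
def completedSet (F : FlatFLRW) : Set R4 :=
  {q | 0 < q.2 2 → q.1 - lapse q.2 / q.2 2 ∈ F.conformalRange}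

theorem continuous_depth : Continuous fun q : R4 ↦ q.2 2 :=
  (contDiff_coord 2).continuous.comp continuous_snd

theorem continuousOn_retardedTime :
    ContinuousOn (fun q : R4 ↦ q.1 - lapse q.2 / q.2 2) {q | 0 < q.2 2} :=
  continuous_fst.continuousOn.sub <|
    (continuous_lapse.comp continuous_snd).continuousOn.div continuous_depth.continuousOn
      fun _ hq ↦ ne_of_gt hq

theorem isOpen_depth_pos_inter : IsOpen {q : R4 | 0 < q.2 2 ∧
    q.1 - lapse q.2 / q.2 2 ∈ F.conformalRange} :=
  continuousOn_retardedTime.isOpen_inter_preimage (isOpen_lt continuous_const continuous_depth)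
    F.isOpen_conformalRange

/-- Only points with `y 2 = 0` need care. The open condition `y 2 * (v - c) < lapse y` holds there,
and where `y 2 > 0` it says that `v - lapse y / y 2 < c`, which lies in the range because the range
is closed downwards. -/
theorem isOpen_completedSet (hI : ¬ BddBelow F.I) (hh : 0 < h)
    (hH : Tendsto F.hubble atBot (𝓝 h)) : IsOpen F.completedSet := by
  set c := F.conformalTime F.baseTime
  have hc := Iic_subset_conformalRange hI hh hH (mem_image_of_mem _ F.baseTime_mem)
  have heq : F.completedSet = ({q : R4 | q.2 2 < 0} ∪ {q : R4 | q.2 2 * (q.1 - c) < lapse q.2}) ∪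
      {q : R4 | 0 < q.2 2 ∧ q.1 - lapse q.2 / q.2 2 ∈ F.conformalRange} := by
    ext q
    constructor
    · intro hq
      rcases lt_trichotomy (q.2 2) 0 with h0 | h0 | h0
      · exact Or.inl (Or.inl h0)
      · refine Or.inl (Or.inr ?_)
        rw [mem_ofPred_eq, h0, zero_mul]
        exact lapse_pos _
      · exact Or.inr ⟨h0, hq h0⟩
    · rintro ((h0 | h0) | h0) h1
      · exact absurd h1 (not_lt.2 (le_of_lt h0))
      · refine hc ?_
        have : q.1 - c < lapse q.2 / q.2 2 := by
          rw [lt_div_iff₀ h1, mul_comm]; exact h0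
        rw [mem_Iic]
        linarith
      · exact h0.2
  rw [heq]
  refine ((isOpen_lt continuous_depth continuous_const).union (isOpen_lt
    (continuous_depth.mul (continuous_fst.sub continuous_const))
    (continuous_lapse.comp continuous_snd))).union isOpen_depth_pos_inter

/-- Lowering `v` never leaves the set, and the slab `v ≤ c` lies in it entirely, so each point is
joined to the slab by a ray. -/
theorem isPreconnected_completedSet (hI : ¬ BddBelow F.I) (hh : 0 < h)
    (hH : Tendsto F.hubble atBot (𝓝 h)) : IsPreconnected F.completedSet := by
  set c := F.conformalTime F.baseTime
  have hc := Iic_subset_conformalRange hI hh hH (mem_image_of_mem _ F.baseTime_mem)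
  refine isPreconnected_of_forall ((c, 0) : R4) fun q hq ↦
    ⟨Iic c ×ˢ univ ∪ Iic q.1 ×ˢ {q.2}, ?_, Or.inl ⟨self_mem_Iic, trivial⟩,
      Or.inr ⟨self_mem_Iic, rfl⟩, ?_⟩
  · rintro p (⟨hp, -⟩ | ⟨hp, hp'⟩) h0
    · refine hc ?_
      have : 0 < lapse p.2 / p.2 2 := div_pos (lapse_pos _) h0
      rw [mem_Iic] at *
      linarith
    · rw [mem_singleton_iff.1 hp'] at h0 ⊢
      refine Iic_subset_conformalRange hI hh hH (hq h0) ?_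
      rw [mem_Iic] at *
      linarith
  · exact IsPreconnected.union (min c q.1, q.2) ⟨mem_Iic.2 (min_le_left _ _), trivial⟩
      ⟨mem_Iic.2 (min_le_right _ _), rfl⟩
      (isPreconnected_Iic.prod isPreconnected_univ)
      (isPreconnected_Iic.prod isPreconnected_singleton)

/-- The square root of the conformal factor relating the FLRW metric to the completed Minkowski
metric, with its continuous extension to `y 2 ≤ 0`. -/
def conformalFactor (F : FlatFLRW) (h : ℝ) (q : R4) : ℝ :=
  if 0 < q.2 2 then F.conformalScale (q.1 - lapse q.2 / q.2 2) / q.2 2 else (h * lapse q.2)⁻¹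

theorem conformalFactor_pos (hh : 0 < h) {q : R4} (hq : q ∈ F.completedSet) :
    0 < F.conformalFactor h q := by
  unfold conformalFactor
  split_ifs with h0
  · exact div_pos (F.conformalScale_pos (hq h0)) h0
  · exact inv_pos.2 (mul_pos hh (lapse_pos _))

/-- From `y 2 > 0` the factor is `(a η) / (y 2 * η)`; here `y 2 * η = y 2 * v - lapse y` tends to
`-lapse y`, whence `η → -∞` and `a η → -1 / h`. -/
theorem continuousAt_conformalFactor_of_eq_zero (hI : ¬ BddBelow F.I) (hh : 0 < h)
    (hH : Tendsto F.hubble atBot (𝓝 h)) {q : R4} (hq : q.2 2 = 0) :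
    ContinuousAt (F.conformalFactor h) q := by
  have hl := lapse_pos q.2
  have hlc : Continuous fun q : R4 ↦ lapse q.2 := continuous_lapse.comp continuous_snd
  have hval : F.conformalFactor h q = (h * lapse q.2)⁻¹ := by simp [conformalFactor, hq]
  rw [ContinuousAt, hval]
  refine Tendsto.if ?_ ?_
  · have hpos : ∀ᶠ p : R4 in 𝓝 q ⊓ 𝓟 {p | 0 < p.2 2}, 0 < p.2 2 :=
      mem_inf_of_right (mem_principal_self _)
    have hd : Tendsto (fun p : R4 ↦ p.2 2) (𝓝 q ⊓ 𝓟 {p | 0 < p.2 2}) (𝓝[>] 0) := by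
      refine tendsto_nhdsWithin_iff.2 ⟨?_, hpos⟩
      rw [← hq]
      exact continuous_depth.continuousAt.tendsto.mono_left inf_le_left
    have hscaled : Tendsto (fun p : R4 ↦ p.2 2 * (p.1 - lapse p.2 / p.2 2))
        (𝓝 q ⊓ 𝓟 {p | 0 < p.2 2}) (𝓝 (-lapse q.2)) := by
      have : Tendsto (fun p : R4 ↦ p.2 2 * p.1 - lapse p.2) (𝓝 q ⊓ 𝓟 {p | 0 < p.2 2})
          (𝓝 (q.2 2 * q.1 - lapse q.2)) :=
        ((continuous_depth.mul continuous_fst).sub hlc).continuousAt.tendsto.mono_left inf_le_left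
      rw [hq, zero_mul, zero_sub] at this
      refine this.congr' (hpos.mono fun p hp ↦ ?_)
      field_simp
    have htime : Tendsto (fun p : R4 ↦ p.1 - lapse p.2 / p.2 2) (𝓝 q ⊓ 𝓟 {p | 0 < p.2 2})
        atBot := by
      refine ((tendsto_inv_nhdsGT_zero.comp hd).atTop_mul_neg (neg_lt_zero.2 hl) hscaled).congr'
        (hpos.mono fun p hp ↦ ?_)
      simp only [Function.comp_apply]
      rw [inv_mul_cancel_left₀ hp.ne']
    have := ((tendsto_conformalScale_mul hI hh hH).comp htime).div hscaled (neg_ne_zero.2 hl.ne')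
    rw [neg_div_neg_eq, inv_eq_one_div, div_div, ← inv_eq_one_div] at this
    refine this.congr' ?_
    -- Cancelling `η` in the quotient requires `η ≠ 0`; eventually it is negative.
    filter_upwards [hpos, htime.eventually (eventually_lt_atBot 0)] with p hp hp'
    simp only [Function.comp_apply, Pi.div_apply]
    rw [mul_div_mul_right _ _ hp'.ne]
  · have : ContinuousAt (fun q : R4 ↦ (h * lapse q.2)⁻¹) q :=
      (continuous_const.mul hlc).continuousAt.inv₀ (mul_pos hh hl).ne'
    exact this.tendsto.mono_left inf_le_left

theorem continuousOn_conformalFactor (hI : ¬ BddBelow F.I) (hh : 0 < h)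
    (hH : Tendsto F.hubble atBot (𝓝 h)) : ContinuousOn (F.conformalFactor h) F.completedSet := by
  intro q hq
  refine ContinuousAt.continuousWithinAt ?_
  have hlc : Continuous fun q : R4 ↦ lapse q.2 := continuous_lapse.comp continuous_snd
  rcases lt_trichotomy (q.2 2) 0 with h0 | h0 | h0
  · have : ContinuousAt (fun q : R4 ↦ (h * lapse q.2)⁻¹) q :=
      (continuous_const.mul hlc).continuousAt.inv₀ (mul_pos hh (lapse_pos _)).ne'
    refine this.congr ?_
    filter_upwards [continuous_depth.continuousAt.eventually (gt_mem_nhds h0)] with p hp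
    exact (if_neg (not_lt.2 hp.le)).symm
  · exact continuousAt_conformalFactor_of_eq_zero hI hh hH h0
  · have h1 : ContinuousAt (fun q : R4 ↦ q.1 - lapse q.2 / q.2 2) q :=
      continuousOn_retardedTime.continuousAt
        ((isOpen_lt continuous_const continuous_depth).mem_nhds h0)
    have h2 : ContinuousAt F.conformalScale (q.1 - lapse q.2 / q.2 2) :=
      F.continuousOn_conformalScale.continuousAt (F.isOpen_conformalRange.mem_nhds (hq h0))
    have h3 : ContinuousAt (fun q : R4 ↦ F.conformalScale (q.1 - lapse q.2 / q.2 2) / q.2 2) q :=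
      ContinuousAt.div (ContinuousAt.comp (f := fun q : R4 ↦ q.1 - lapse q.2 / q.2 2) h2 h1)
        continuous_depth.continuousAt h0.ne'
    refine h3.congr ?_
    filter_upwards [continuous_depth.continuousAt.eventually (lt_mem_nhds h0)] with p hp
    exact (if_pos hp).symm

/-- The extended metric. -/
def extendedMetricAt (F : FlatFLRW) (h : ℝ) (q : R4) : R4 →L[ℝ] R4 →L[ℝ] ℝ :=
  F.conformalFactor h q ^ 2 • completedForm q.2

theorem extendedMetricAt_apply (q v w : R4) : F.extendedMetricAt h q v w
    = F.conformalFactor h q ^ 2 * completedForm q.2 v w := rfl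

/-- The carrier of the extension. -/
def completedDomain (hI : ¬ BddBelow F.I) (hh : 0 < h)
    (hH : Tendsto F.hubble atBot (𝓝 h)) : Opens R4 :=
  ⟨F.completedSet, isOpen_completedSet hI hh hH⟩

theorem connectedSpace_completedDomain (hI : ¬ BddBelow F.I) (hh : 0 < h)
    (hH : Tendsto F.hubble atBot (𝓝 h)) : ConnectedSpace (completedDomain hI hh hH) := by
  refine isConnected_iff_connectedSpace.1 ⟨⟨(0, 0), fun h0 ↦ ?_⟩,
    isPreconnected_completedSet hI hh hH⟩
  simp at h0

/-- The `C^0` extension of a past-asymptotically de Sitter spacetime through past null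
infinity of the conformally related Minkowski space. -/
def extension (hI : ¬ BddBelow F.I) (hh : 0 < h)
    (hH : Tendsto F.hubble atBot (𝓝 h)) : Spacetime 0 :=
  haveI := connectedSpace_completedDomain hI hh hH
  { carrier := completedDomain hI hh hH
    metric := fun q ↦ F.extendedMetricAt h q
    lorentz := fun q ↦ isLorentzForm_smul_completedForm
      (pow_pos (conformalFactor_pos hh q.2) 2) _
    contMDiff_metric := contMDiff_metric_opens (completedDomain hI hh hH) (F.extendedMetricAt h)
      (contDiffOn_zero.2 (((continuousOn_conformalFactor hI hh hH).pow 2).smul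
        (continuous_completedForm.comp continuous_snd).continuousOn)) _ fun _ ↦ rfl
    timeField := fun q ↦ normalVector (q : R4).2
    timelike_timeField := fun q ↦ by
      change F.extendedMetricAt h q (normalVector (q : R4).2) (normalVector (q : R4).2) < 0
      rw [extendedMetricAt_apply, completedForm_normalVector]
      have h1 := conformalFactor_pos hh q.2
      have h2 := lapse_pos (q : R4).2
      have : (normalVector (q : R4).2).1 = 1 := rfl
      rw [this, mul_neg, neg_lt_zero]
      positivity
    continuous_timeField :=
      continuous_vectorField_opens (completedDomain hI hh hH) (fun q ↦ normalVector q.2)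
        (continuous_const.prodMk (continuous_shift.comp continuous_snd).neg).continuousOn _
        fun _ ↦ rfl }

/-- The time field is dual to a negative multiple of `dv`, so the time orientation is read off from
the sign of `dv`; the conformal factor plays no role. -/
theorem isFutureTimelike_extension_iff (hI : ¬ BddBelow F.I) (hh : 0 < h)
    (hH : Tendsto F.hubble atBot (𝓝 h)) (q : completedDomain hI hh hH) (v : R4) :
    (extension hI hh hH).IsFutureTimelike q v ↔
      completedForm (q : R4).2 v v < 0 ∧ 0 < v.1 := by
  have h1 := conformalFactor_pos hh q.2
  have h2 := lapse_pos (q : R4).2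
  have h3 : 0 < F.conformalFactor h q ^ 2 := by positivity
  have h4 : 0 < lapse (q : R4).2 ^ 2 := by positivity
  change F.extendedMetricAt h q v v < 0 ∧
    F.extendedMetricAt h q v (normalVector (q : R4).2) < 0 ↔ _
  rw [extendedMetricAt_apply, extendedMetricAt_apply, completedForm_normalVector, mul_neg,
    neg_lt_zero, mul_pos_iff_of_pos_left h3, mul_pos_iff_of_pos_left h4,
    mul_neg_iff_of_pos h3]

/-! ### The isometric embedding -/

/-- The embedding in the coordinates of `ℝ⁴`. -/
def embeddingMap (F : FlatFLRW) (p : R4) : R4 := (F.conformalTime p.1 + height p.2, horo p.2)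

theorem retardedTime_embeddingMap (p : R4) :
    (F.embeddingMap p).1 - lapse (F.embeddingMap p).2 / (F.embeddingMap p).2 2
      = F.conformalTime p.1 := by
  have := (horo_two_pos p.2).ne'
  rw [embeddingMap, lapse_horo]
  field_simp
  ring

theorem embeddingMap_mem {p : R4} (hp : p.1 ∈ F.I) : F.embeddingMap p ∈ F.completedSet := by
  intro _
  rw [retardedTime_embeddingMap]
  exact mem_image_of_mem _ hp

theorem contDiffOn_embeddingMap : ContDiffOn ℝ 1 F.embeddingMap F.domain :=
  ((F.contDiffOn_conformalTime.comp contDiff_fst.contDiffOn fun _ hp ↦ hp).add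
    ((contDiff_height.of_le (by simp)).comp contDiff_snd).contDiffOn).prodMk
    ((contDiff_horo.of_le (by simp)).comp contDiff_snd).contDiffOn

/-- The derivative of the embedding. -/
def embeddingDeriv (F : FlatFLRW) (p : R4) : R4 →L[ℝ] R4 :=
  ((F.a p.1)⁻¹ • ContinuousLinearMap.fst ℝ ℝ E3
      + ((height p.2)⁻¹ • innerSL ℝ p.2).comp (ContinuousLinearMap.snd ℝ ℝ E3)).prod
    ((horoDeriv p.2).comp (ContinuousLinearMap.snd ℝ ℝ E3))

theorem embeddingDeriv_apply (p v : R4) : F.embeddingDeriv p v =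
    ((F.a p.1)⁻¹ * v.1 + (height p.2)⁻¹ * inner ℝ p.2 v.2, horoDeriv p.2 v.2) := by
  simp [embeddingDeriv]

theorem hasFDerivAt_embeddingMap {p : R4} (hp : p.1 ∈ F.I) :
    HasFDerivAt F.embeddingMap (F.embeddingDeriv p) p :=
  (((F.hasDerivAt_conformalTime hp).comp_hasFDerivAt p hasFDerivAt_fst).add
    ((hasFDerivAt_height p.2).comp p hasFDerivAt_snd)).prodMk
    ((hasFDerivAt_horo p.2).comp p hasFDerivAt_snd)

/-- On the image the factor is `a / y 2`; its square cancels the `(y 2)²` of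
`completedForm_horoDeriv` and turns `-dη² + |dx|²` into the FLRW metric. -/
theorem extendedMetricAt_embeddingDeriv {p : R4} (hp : p.1 ∈ F.I) (v w : R4) :
    F.extendedMetricAt h (F.embeddingMap p) (F.embeddingDeriv p v) (F.embeddingDeriv p w)
      = F.metricAt p v w := by
  have ha := (F.a_pos _ hp).ne'
  have hs := (horo_two_pos p.2).ne'
  have hc : F.conformalFactor h (F.embeddingMap p) = F.a p.1 / horo p.2 2 := by
    rw [conformalFactor, if_pos (show 0 < (F.embeddingMap p).2 2 from horo_two_pos p.2),
      retardedTime_embeddingMap, conformalScale,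
      F.timeOf_conformalTime hp]
    rfl
  rw [extendedMetricAt_apply, hc, embeddingDeriv_apply, embeddingDeriv_apply]
  change _ * completedForm (horo p.2) _ _ = _
  rw [completedForm_horoDeriv, metricAt_apply]
  field_simp

/-- Timelikeness means `|dx| < dη`, while by Cauchy–Schwarz the height changes by at least `-|dx|`,
since `|x| ≤ height x`. So `dv > 0`. -/
theorem embeddingDeriv_fst_pos {p v : R4} (hp : p.1 ∈ F.I) (hv : F.metricAt p v v < 0)
    (hv1 : 0 < v.1) : 0 < (F.embeddingDeriv p v).1 := by
  have ha := F.a_pos _ hp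
  have hr := height_pos p.2
  rw [metricAt_apply, real_inner_self_eq_norm_sq] at hv
  have h1 : F.a p.1 * ‖v.2‖ < v.1 := by
    refine lt_of_pow_lt_pow_left₀ 2 hv1.le ?_
    rw [mul_pow]; linarith
  have h2 : -(height p.2 * ‖v.2‖) ≤ inner ℝ p.2 v.2 :=
    (neg_le_neg (mul_le_mul_of_nonneg_right (norm_le_height p.2) (norm_nonneg _))).trans
      (neg_le_of_abs_le (abs_real_inner_le_norm _ _))
  rw [embeddingDeriv_apply]
  change 0 < (F.a p.1)⁻¹ * v.1 + (height p.2)⁻¹ * inner ℝ p.2 v.2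
  have h3 : ‖v.2‖ < (F.a p.1)⁻¹ * v.1 := by
    rw [← div_eq_inv_mul, lt_div_iff₀ ha]; linarith
  have h4 : -‖v.2‖ ≤ (height p.2)⁻¹ * inner ℝ p.2 v.2 := by
    rw [← div_eq_inv_mul, le_div_iff₀ hr]; linarith
  linarith

/-- The embedding of the spacetime into its extension. -/
def embedding (hI : ¬ BddBelow F.I) (hh : 0 < h) (hH : Tendsto F.hubble atBot (𝓝 h))
    (p : F.domain) : completedDomain hI hh hH :=
  ⟨F.embeddingMap p, embeddingMap_mem p.2⟩

theorem range_embedding (hI : ¬ BddBelow F.I) (hh : 0 < h)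
    (hH : Tendsto F.hubble atBot (𝓝 h)) :
    range (embedding hI hh hH) = {q : completedDomain hI hh hH | 0 < (q : R4).2 2} := by
  ext q
  constructor
  · rintro ⟨p, rfl⟩
    exact horo_two_pos _
  · intro hq
    have hq' := q.2 hq
    refine ⟨⟨(F.timeOf ((q : R4).1 - lapse (q : R4).2 / (q : R4).2 2), horoInv (q : R4).2),
      F.timeOf_mem hq'⟩, Subtype.ext (Prod.ext ?_ ?_)⟩
    · change F.conformalTime (F.timeOf _) + height (horoInv _) = _
      rw [F.conformalTime_timeOf hq', height_horoInv hq]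
      ring
    · exact horo_horoInv hq

theorem continuous_embedding (hI : ¬ BddBelow F.I) (hh : 0 < h)
    (hH : Tendsto F.hubble atBot (𝓝 h)) : Continuous (embedding hI hh hH) :=
  (continuousOn_iff_continuous_domRestrict.1 contDiffOn_embeddingMap.continuousOn).subtype_mk _

/-- The range is the open set `y 2 > 0`, and on it `timeOf` and `horoInv` give a continuous left
inverse. -/
theorem isOpenEmbedding_embedding (hI : ¬ BddBelow F.I) (hh : 0 < h)
    (hH : Tendsto F.hubble atBot (𝓝 h)) : IsOpenEmbedding (embedding hI hh hH) := by
  have hdepth : IsOpen {q : completedDomain hI hh hH | 0 < (q : R4).2 2} :=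
    isOpen_lt continuous_const (continuous_depth.comp continuous_subtype_val)
  have hsub : ∀ q : {q : completedDomain hI hh hH | 0 < (q : R4).2 2},
      (q : R4).1 - lapse (q : R4).2 / (q : R4).2 2 ∈ F.conformalRange := fun q ↦ q.1.2 q.2
  let f : F.domain → {q : completedDomain hI hh hH | 0 < (q : R4).2 2} := fun p ↦
    ⟨embedding hI hh hH p, horo_two_pos _⟩
  let g : {q : completedDomain hI hh hH | 0 < (q : R4).2 2} → F.domain := fun q ↦
    ⟨(F.timeOf ((q : R4).1 - lapse (q : R4).2 / (q : R4).2 2), horoInv (q : R4).2),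
      F.timeOf_mem (hsub q)⟩
  have hval : Continuous fun q : {q : completedDomain hI hh hH | 0 < (q : R4).2 2} ↦ (q : R4) :=
    continuous_subtype_val.comp continuous_subtype_val
  have hg : Continuous g := by
    refine Continuous.subtype_mk (Continuous.prodMk ?_ ?_) _
    · exact F.continuousOn_timeOf.comp_continuous
        (continuousOn_retardedTime.comp_continuous hval fun q ↦ q.2) hsub
    · exact continuousOn_horoInv.comp_continuous (continuous_snd.comp hval) fun q ↦ q.2
  have hgf : Function.LeftInverse g f := fun p ↦ by
    refine Subtype.ext (Prod.ext ?_ (horoInv_horo _))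
    change F.timeOf ((F.embeddingMap p).1 - lapse (F.embeddingMap p).2 / (F.embeddingMap p).2 2)
      = (p : R4).1
    rw [retardedTime_embeddingMap, F.timeOf_conformalTime p.2]
  refine ⟨IsEmbedding.subtypeVal.comp
    (hgf.isEmbedding hg ((continuous_embedding hI hh hH).subtype_mk _)), ?_⟩
  rw [range_embedding]
  exact hdepth

theorem hasMFDerivAt_embedding (hI : ¬ BddBelow F.I) (hh : 0 < h)
    (hH : Tendsto F.hubble atBot (𝓝 h)) (p : F.domain) :
    HasMFDerivAt 𝓘(ℝ, R4) 𝓘(ℝ, R4) (embedding hI hh hH) p (F.embeddingDeriv p) :=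
  hasMFDerivAt_opens (Φ := F.embeddingMap) (fun _ ↦ rfl) (hasFDerivAt_embeddingMap p.2)

theorem contMDiff_embedding (hI : ¬ BddBelow F.I) (hh : 0 < h)
    (hH : Tendsto F.hubble atBot (𝓝 h)) :
    ContMDiff 𝓘(ℝ, R4) 𝓘(ℝ, R4) 1 (embedding hI hh hH) := fun p ↦
  (contMDiffWithinAt_subtypeVal_comp_iff (completedDomain hI hh hH) (embedding hI hh hH) _ p).1
    (contMDiffAt_subtype_iff.2
      (contDiffOn_embeddingMap.contDiffAt (F.domain.2.mem_nhds p.2)).contMDiffAt)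

theorem range_embedding_ne_univ (hI : ¬ BddBelow F.I) (hh : 0 < h)
    (hH : Tendsto F.hubble atBot (𝓝 h)) : range (embedding hI hh hH) ≠ univ := by
  rw [range_embedding]
  intro hu
  have : (⟨(0, 0), fun h0 ↦ by simp at h0⟩ : completedDomain hI hh hH) ∈
    {q : completedDomain hI hh hH | 0 < (q : R4).2 2} := hu ▸ mem_univ _
  simp at this

theorem mfderiv_embedding (hI : ¬ BddBelow F.I) (hh : 0 < h)
    (hH : Tendsto F.hubble atBot (𝓝 h)) (p : F.spacetime.carrier) :
    mfderiv 𝓘(ℝ, R4) 𝓘(ℝ, R4) (M := F.spacetime.carrier)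
      (M' := (extension hI hh hH).carrier) (embedding hI hh hH) p
      = F.embeddingDeriv (Subtype.val (p := fun q ↦ q ∈ F.domain) p) :=
  (hasMFDerivAt_embedding hI hh hH p).mfderiv

theorem isFutureTimelike_embeddingDeriv (hI : ¬ BddBelow F.I) (hh : 0 < h)
    (hH : Tendsto F.hubble atBot (𝓝 h)) (p : F.domain) (v : R4)
    (hv : F.spacetime.IsFutureTimelike p v) :
    (extension hI hh hH).IsFutureTimelike (embedding hI hh hH p) (F.embeddingDeriv p v) := by
  have hv1 : F.metricAt p v v < 0 := hv.1
  have hv2 : F.metricAt p v ((1, 0) : R4) < 0 := hv.2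
  rw [metricAt_apply] at hv2
  refine (isFutureTimelike_extension_iff hI hh hH _ _).2
    ⟨?_, embeddingDeriv_fst_pos p.2 hv1 (by simpa using hv2)⟩
  rw [← extendedMetricAt_embeddingDeriv (h := h) p.2 v v, extendedMetricAt_apply] at hv1
  exact (mul_neg_iff_of_pos (pow_pos (conformalFactor_pos hh (embeddingMap_mem p.2)) 2)).1 hv1

theorem isExtension_embedding (hI : ¬ BddBelow F.I) (hh : 0 < h)
    (hH : Tendsto F.hubble atBot (𝓝 h)) :
    Spacetime.IsExtension F.spacetime (extension hI hh hH) (embedding hI hh hH) where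
  contMDiff := ContMDiff.of_le (n := 1) (contMDiff_embedding hI hh hH) (by simp)
  isOpenEmbedding := isOpenEmbedding_embedding hI hh hH
  range_ne_univ := range_embedding_ne_univ hI hh hH
  isometry := fun p v w ↦ by
    rw [mfderiv_embedding]
    exact extendedMetricAt_embeddingDeriv
      (Subtype.property (p := fun q ↦ q ∈ F.domain) p) v w
  futureTimelike := fun p v hv ↦ by
    rw [mfderiv_embedding]
    exact isFutureTimelike_embeddingDeriv hI hh hH p v hv

/-! ### A timelike curve from the past boundary -/

/-- A straight line leaving the boundary of the embedded spacetime. -/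
def boundaryLine (τ : ℝ) : R4 := (τ, (τ / 2) • axis)

theorem boundaryLine_depth (τ : ℝ) : (boundaryLine τ).2 2 = τ / 2 := by simp [boundaryLine]

theorem lapse_boundaryLine (τ : ℝ) : lapse (boundaryLine τ).2 = (1 + τ ^ 2 / 4) / 2 := by
  rw [lapse, E3.norm_sq_eq]
  simp [boundaryLine]
  ring

theorem hasFDerivAt_boundaryLine (τ : ℝ) : HasFDerivAt boundaryLine
    (ContinuousLinearMap.toSpanSingleton ℝ (((1 : ℝ), (1 / 2 : ℝ) • axis) : R4)) τ := by
  have h : HasDerivAt boundaryLine (((1 : ℝ), (1 / 2 : ℝ) • axis) : R4) τ :=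
    (hasDerivAt_id τ).prodMk (((hasDerivAt_id τ).div_const 2).smul_const axis)
  exact h.hasFDerivAt

theorem contDiff_boundaryLine : ContDiff ℝ 1 boundaryLine :=
  contDiff_id.prodMk ((contDiff_id.div_const 2).smul contDiff_const)

/-- The slope `1 / 2` makes the velocity equal to `normalVector 0` at `τ = 0`. The value of the form
is `-1/4 - τ²/8`. -/
theorem completedForm_boundaryLine (τ : ℝ) : completedForm (boundaryLine τ).2
    (((1 : ℝ), (1 / 2 : ℝ) • axis) : R4) (((1 : ℝ), (1 / 2 : ℝ) • axis) : R4) < 0 := by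
  rw [completedForm_apply, shift, boundaryLine_depth, lapse_boundaryLine, E3.inner_eq]
  simp [boundaryLine]
  nlinarith [sq_nonneg τ, sq_nonneg (τ ^ 2)]

theorem exists_boundaryLine_mem (hI : ¬ BddBelow F.I) (hh : 0 < h)
    (hH : Tendsto F.hubble atBot (𝓝 h)) :
    ∃ b > 0, ∀ τ ∈ Icc 0 b, boundaryLine τ ∈ F.completedSet := by
  have h0 : boundaryLine 0 ∈ F.completedSet := fun h0 ↦ by simp [boundaryLine_depth] at h0
  have h1 := contDiff_boundaryLine.continuous.continuousAt.preimage_mem_nhds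
    ((isOpen_completedSet hI hh hH).mem_nhds h0)
  obtain ⟨b, hb, hsub⟩ := Metric.mem_nhds_iff.1 h1
  refine ⟨b / 2, half_pos hb, fun τ hτ ↦ hsub ?_⟩
  rw [Metric.mem_ball, Real.dist_eq, sub_zero, abs_of_nonneg hτ.1]
  linarith [hτ.2]

theorem pastBoundary_embedding_nonempty (hI : ¬ BddBelow F.I) (hh : 0 < h)
    (hH : Tendsto F.hubble atBot (𝓝 h)) :
    (Spacetime.pastBoundary F.spacetime (extension hI hh hH) (embedding hI hh hH)).Nonempty := by
  obtain ⟨b, hb, hmem⟩ := exists_boundaryLine_mem hI hh hH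
  -- A curve is a function on all of `ℝ`, but the line is known to stay in the region only for `τ`
  -- in `[0, b]`; so the parameter is clamped.
  let γ : ℝ → completedDomain hI hh hH := fun τ ↦
    ⟨boundaryLine (projIcc 0 b hb.le τ), hmem _ (projIcc 0 b hb.le τ).2⟩
  have hγ : ∀ τ ∈ Icc 0 b, (γ τ : R4) = boundaryLine τ := fun τ hτ ↦ by
    simp only [γ, projIcc_of_mem hb.le hτ]
  have hrange : ∀ τ ∈ Ioc 0 b, γ τ ∈ range (embedding hI hh hH) := fun τ hτ ↦ by
    rw [range_embedding, mem_ofPred_eq, hγ τ (Ioc_subset_Icc_self hτ), boundaryLine_depth]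
    exact half_pos hτ.1
  have hγc : Continuous γ := Continuous.subtype_mk
    (contDiff_boundaryLine.continuous.comp (continuous_subtype_val.comp continuous_projIcc)) _
  have hfrontier : γ 0 ∈ frontier (range (embedding hI hh hH)) := by
    rw [(isOpenEmbedding_embedding hI hh hH).isOpen_range.frontier_eq]
    refine ⟨?_, fun h0 ↦ ?_⟩
    · refine mem_closure_of_tendsto (b := 𝓝[>] 0) (hγc.continuousAt.tendsto.mono_left
        nhdsWithin_le_nhds) ?_
      filter_upwards [Ioc_mem_nhdsGT hb] with τ hτ using hrange τ hτ
    · rw [range_embedding, mem_ofPred_eq, hγ 0 ⟨le_rfl, hb.le⟩, boundaryLine_depth] at h0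
      simp at h0
  -- The subdivision has the single piece `[0, b]`.
  refine ⟨γ 0, hfrontier, γ, 0, b, ⟨hb, 1, fun n ↦ n * b, by simp, by simp, fun i hi ↦ ?_⟩,
    rfl, hrange⟩
  · obtain rfl : i = 0 := by omega
    simp only [Nat.cast_zero, zero_mul, zero_add, Nat.cast_one, one_mul]
    refine ⟨hb, fun τ hτ ↦ ?_, fun τ hτ ↦ ?_⟩
    · refine (contMDiffWithinAt_subtypeVal_comp_iff (completedDomain hI hh hH) γ _ τ).1 ?_
      exact (contDiff_boundaryLine.contMDiff.contMDiffAt.contMDiffWithinAt).congr hγ (hγ τ hτ)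
    · have hd := hasMFDerivWithinAt_curve_opens hγ hτ (hasFDerivAt_boundaryLine τ)
      have hu : UniqueMDiffWithinAt 𝓘(ℝ, ℝ) (Icc 0 b) τ :=
        uniqueMDiffWithinAt_iff_uniqueDiffWithinAt.2 (uniqueDiffOn_Icc hb τ hτ)
      have he := DFunLike.congr_fun (hd.mfderivWithin hu) (1 : ℝ)
      have hv : ContinuousLinearMap.toSpanSingleton ℝ (((1 : ℝ), (1 / 2 : ℝ) • axis) : R4) (1 : ℝ)
        = ((1 : ℝ), (1 / 2 : ℝ) • axis) := by simp
      refine (isFutureTimelike_extension_iff hI hh hH (γ τ) _).2 ?_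
      erw [he, hv]
      rw [hγ τ hτ]
      exact ⟨completedForm_boundaryLine τ, one_pos⟩

end FlatFLRW

end

theorem corollary3p6 (F : FlatFLRW) (hF : F.IsPastAsymptoticallyDeSitter) :
    ∃ (N : Spacetime 0) (φ : F.spacetime.carrier → N.carrier),
      Spacetime.IsExtension F.spacetime N φ ∧ (Spacetime.pastBoundary F.spacetime N φ).Nonempty := by
  obtain ⟨hI, h, hh, hH, -⟩ := hF
  exact ⟨FlatFLRW.extension hI hh hH, FlatFLRW.embedding hI hh hH,
    FlatFLRW.isExtension_embedding hI hh hH, FlatFLRW.pastBoundary_embedding_nonempty hI hh hH⟩
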